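/- Let $X=\{0,1\}$ and let $T=X^*$ be the binary rooted tree of finite words over $X$ (root: the empty word; $v$ is adjacent to $vx$ for $x\in X$), with boundary $X^\omega$. Let $a,b$ be the automorphisms of $T$ defined by the wreath recursion $a=(b,a)\sigma$, $b=(b,a)$, that is, for all words $w$, $$a(0w)=1\,b(w),\quad a(1w)=0\,a(w),\quad b(0w)=0\,b(w),\quad b(1w)=1\,a(w)$$ (the generators of the lamplighter group given by its two-state automaton). For a group $G$ of automorphisms of $T$, the orbit tree $T_G$ is the rooted graph whose vertices are the orbits of $G$ on the vertices of $T$, two orbits being adjacent if and only if they contain adjacent vertices of $T$; its root is the orbit of the empty word. Its $n$-th level is the set of vertices at distance $n$ from the root, and the children of a vertex are the adjacent vertices on the next level. The space of ergodic components of $G$ on $X^\omega$ is the set of all ergodic $G$-invariant Borel probability measures on $X^\omega$ with the topology of weak convergence. Theorem. (a) In the orbit tree $T_{\langle a\rangle}$ all vertices on the levels $2^n-1$, $n\ge 0$, have exactly one child, and all vertices on other levels have exactly two children. The space of ergodic components of the action of $\langle a\rangle$ on $X^\omega$ is homeomorphic to the Cantor set. (b) The root of the orbit tree $T_{\langle b\rangle}$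 has exactly two children; the subtree of $T_{\langle b\rangle}$ hanging down from one of them is isomorphic, as a rooted tree, to $T_{\langle b\rangle}$, and the subtree hanging down from the other is isomorphic, as a rooted tree, to $T_{\langle a\rangle}$. The space of ergodic components of the action of $\langle b\rangle$ on $X^\omega$ is homeomorphic to the Cantor set. -/

import Mathlib

open MeasureTheory

/-! ### Rooted trees

A rooted tree is given by a graph `T` together with a distinguished vertex `r`, its root. -/

section RootedTrees

variable {V W : Type*}

/-- The `n`-th level of the rooted tree `(T, r)`: the vertices at combinatorial distance `n`
from the root. -/
def treeLevel (T : SimpleGraph V) (r : V) (n : ℕ) : Set V :=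
  {v | T.edist r v = n}

/-- The children of `v` in `(T, r)`: the vertices adjacent to `v` that are one level below `v`. -/
def treeChildren (T : SimpleGraph V) (r v : V) : Set V :=
  {w | T.Adj v w ∧ T.edist r w = T.edist r v + 1}

/-- The vertices of the subtree of `(T, r)` hanging down from `v`: the vertices `w` such that
`v` lies on the geodesic from the root to `w` (this includes `w = v`). -/
def treeBelow (T : SimpleGraph V) (r v : V) : Set V :=
  {w | T.edist r w = T.edist r v + T.edist v w}

/-- The subtree of `(T, r)` hanging down from `v`, rooted at `v`, is isomorphic, as a rooted
tree, to `(S, s)`. -/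
def SubtreeIsoTo (T : SimpleGraph V) (r v : V) (S : SimpleGraph W) (s : W) : Prop :=
  ∃ φ : T.induce (treeBelow T r v) ≃g S, ∀ x : treeBelow T r v, (x : V) = v → φ x = s

/-- The orbit tree of a group `G` acting on (the vertices of) `T`: its vertices are the orbits,
and two orbits are adjacent iff they contain adjacent vertices. (For automorphisms of a rooted
tree adjacent vertices lie on different levels, hence in different orbits, so that the
condition `O ≠ P` is then automatic.) -/
def orbitTree (G : Type*) [Group G] [MulAction G V] (T : SimpleGraph V) :
    SimpleGraph (MulAction.orbitRel.Quotient G V) where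
  Adj O P := O ≠ P ∧ ∃ v ∈ O.orbit, ∃ w ∈ P.orbit, T.Adj v w
  symm := ⟨fun _ _ ⟨h, v, hv, w, hw, hvw⟩ => ⟨h.symm, w, hw, v, hv, hvw.symm⟩⟩
  loopless := ⟨fun _ h => h.1 rfl⟩

end RootedTrees

/-! ### The tree of words and its automorphisms -/

section WordTree

variable {X : Type*}

/-- The tree `X*` of finite words over `X`: the words `v` and `vx` are adjacent. Its root is the
empty word `[]`. -/
def wordTree (X : Type*) : SimpleGraph (List X) where
  Adj v w := (∃ x, w = v ++ [x]) ∨ (∃ x, v = w ++ [x])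
  symm := ⟨fun _ _ h => h.symm⟩
  loopless := ⟨fun v h => by
    rcases h with ⟨x, h⟩ | ⟨x, h⟩ <;> simpa using congrArg List.length h⟩

/-- The group of automorphisms of the tree `X*` that preserve the root, with composition as its
multiplication; as a group of automorphisms of the graph it acts on the vertices `List X`. -/
abbrev TreeAut (X : Type*) : Type _ :=
  ↥(MulAction.stabilizer (wordTree X ≃g wordTree X) ([] : List X))

/-- The root of the orbit tree of the action of `G` on `X*`. -/
def orbitRoot (G : Subgroup (TreeAut X)) : MulAction.orbitRel.Quotient G (List X) :=
  Quotient.mk _ []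

/-- The `n`-th vertex `x₀x₁…x_{n-1}` on the path `ξ = x₀x₁x₂…`. -/
def wordPrefix (ξ : ℕ → X) (n : ℕ) : List X := (List.range n).map ξ

theorem TreeAut.smul_nil (g : TreeAut X) : g • ([] : List X) = [] := g.2

theorem TreeAut.smul_adj (g : TreeAut X) {v w : List X} (h : (wordTree X).Adj v w) :
    (wordTree X).Adj (g • v) (g • w) :=
  (g.1.map_rel_iff (a := v) (b := w)).2 h

theorem TreeAut.smul_concat (g : TreeAut X) (v : List X) :
    ∀ x : X, ∃ y : X, g • (v ++ [x]) = g • v ++ [y] := by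
  induction v using List.reverseRecOn with
  | nil =>
    intro x
    have h := g.smul_adj (v := []) (w := [] ++ [x]) (Or.inl ⟨x, rfl⟩)
    rcases h with h | ⟨y, h⟩
    · exact h
    · rw [g.smul_nil] at h
      simp at h
  | append_singleton u z ih =>
    intro x
    have h := g.smul_adj (v := u ++ [z]) (w := u ++ [z] ++ [x]) (Or.inl ⟨x, rfl⟩)
    rcases h with h | ⟨y, h⟩
    · exact h
    · obtain ⟨y', hy'⟩ := ih z
      rw [hy'] at h
      have h2 := (List.append_inj' h rfl).1
      have h3 : u = u ++ [z] ++ [x] := MulAction.injective g h2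
      simpa using congrArg List.length h3

theorem TreeAut.length_smul (g : TreeAut X) (v : List X) : (g • v).length = v.length := by
  induction v using List.reverseRecOn with
  | nil => rw [g.smul_nil]
  | append_singleton u z ih =>
    obtain ⟨y, hy⟩ := g.smul_concat u z
    simp [hy, ih]

theorem length_wordPrefix (ξ : ℕ → X) (n : ℕ) : (wordPrefix ξ n).length = n := by
  simp [wordPrefix]

theorem wordPrefix_succ (ξ : ℕ → X) (n : ℕ) :
    wordPrefix ξ (n + 1) = wordPrefix ξ n ++ [ξ n] := by
  simp [wordPrefix, List.range_succ]

/-- The action of an automorphism of `X*` on the boundary `X^ω`, the set of infinite words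
(infinite paths from the root): the `n`-th letter of `g(ξ)` is the `n`-th letter of the image
under `g` of any long enough prefix of `ξ`. -/
def boundaryMap (g : TreeAut X) (ξ : ℕ → X) (n : ℕ) : X :=
  (g • wordPrefix ξ (n + 1))[n]'(by simp [TreeAut.length_smul, length_wordPrefix])

theorem wordPrefix_boundaryMap (g : TreeAut X) (ξ : ℕ → X) (n : ℕ) :
    wordPrefix (boundaryMap g ξ) n = g • wordPrefix ξ n := by
  induction n with
  | zero => simp [wordPrefix, TreeAut.smul_nil]
  | succ n ih =>
    obtain ⟨y, hy⟩ := g.smul_concat (wordPrefix ξ n) (ξ n)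
    have hb : boundaryMap g ξ n = y := by
      simp [boundaryMap, wordPrefix_succ, hy, TreeAut.length_smul, length_wordPrefix]
    rw [wordPrefix_succ, ih, wordPrefix_succ, hy, hb]

theorem wordPrefix_injective : Function.Injective (wordPrefix : (ℕ → X) → ℕ → List X) := by
  intro ξ η h
  funext n
  have h1 := congrFun h (n + 1)
  rw [wordPrefix_succ, wordPrefix_succ, congrFun h n] at h1
  simpa using h1

/-- The action of the automorphisms of `X*` on the boundary `X^ω`. -/
instance boundaryAction : MulAction (TreeAut X) (ℕ → X) where
  smul := boundaryMap
  one_smul ξ := wordPrefix_injective <| funext fun n => by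
    change wordPrefix (boundaryMap 1 ξ) n = _
    rw [wordPrefix_boundaryMap, one_smul]
  mul_smul g h ξ := wordPrefix_injective <| funext fun n => by
    change wordPrefix (boundaryMap (g * h) ξ) n =
      wordPrefix (boundaryMap g (boundaryMap h ξ)) n
    simp only [wordPrefix_boundaryMap, mul_smul]

/-- The space of ergodic components of the action of `G` on `X^ω` (binary alphabet): the set of
all ergodic `G`-invariant Borel probability measures on `X^ω`, with the topology induced by the
topology of weak convergence of measures. (`ErgodicSMul` includes invariance.) -/
def ergodicMeasures (G : Subgroup (TreeAut Bool)) : Set (ProbabilityMeasure (ℕ → Bool)) :=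
  {μ | ErgodicSMul G (ℕ → Bool) (μ : Measure (ℕ → Bool))}

end WordTree

/-! ### Invertible automata -/

/-- An invertible (Mealy) automaton with the set of states `Q` over the alphabet `X`: the
transition function, and the output function, which for every state is a permutation of the
alphabet. -/
structure InvAutomaton (Q X : Type*) where
  next : Q → X → Q
  out : Q → Equiv.Perm X

namespace InvAutomaton

variable {Q X : Type*} (A : InvAutomaton Q X)

/-- The transformation of words defined by the state `q`. -/
def run : Q → List X → List X
  | _, [] => []
  | q, x :: w => A.out q x :: run (A.next q x) w

/-- The inverse of `A.run q`. -/
def runInv : Q → List X → List X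
  | _, [] => []
  | q, y :: w => (A.out q).symm y :: runInv (A.next q ((A.out q).symm y)) w

theorem runInv_run (q : Q) (w : List X) : A.runInv q (A.run q w) = w := by
  induction w generalizing q with
  | nil => rfl
  | cons x w ih => simp [run, runInv, ih]

theorem run_runInv (q : Q) (w : List X) : A.run q (A.runInv q w) = w := by
  induction w generalizing q with
  | nil => rfl
  | cons x w ih => simp [run, runInv, ih]

theorem run_concat (q : Q) (w : List X) (x : X) : ∃ y, A.run q (w ++ [x]) = A.run q w ++ [y] := by
  induction w generalizing q with
  | nil => exact ⟨_, rfl⟩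
  | cons z w ih =>
    obtain ⟨y, hy⟩ := ih (A.next q z)
    exact ⟨y, by simp [run, hy]⟩

theorem runInv_concat (q : Q) (w : List X) (x : X) :
    ∃ y, A.runInv q (w ++ [x]) = A.runInv q w ++ [y] := by
  induction w generalizing q with
  | nil => exact ⟨_, rfl⟩
  | cons z w ih =>
    obtain ⟨y, hy⟩ := ih (A.next q ((A.out q).symm z))
    exact ⟨y, by simp [runInv, hy]⟩

/-- The automorphism of the tree `X*` defined by the state `q`. -/
def toTreeAut (q : Q) : TreeAut X :=
  ⟨{ toFun := A.run q
     invFun := A.runInv q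
     left_inv := A.runInv_run q
     right_inv := A.run_runInv q
     map_rel_iff' := by
       have key : ∀ v w : List X,
           (∃ x, A.run q w = A.run q v ++ [x]) ↔ ∃ x, w = v ++ [x] := by
         intro v w
         constructor
         · rintro ⟨x, h⟩
           obtain ⟨y, hy⟩ := A.runInv_concat q (A.run q v) x
           exact ⟨y, by rw [← A.runInv_run q w, h, hy, A.runInv_run]⟩
         · rintro ⟨x, rfl⟩
           exact A.run_concat q v x
       intro v w
       exact or_congr (key v w) (key w v) }, rfl⟩

end InvAutomaton

/-! ### The lamplighter automaton -/

/-- The two states of the lamplighter automaton. -/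
inductive LampState
  | a
  | b

/-- The lamplighter automaton over the alphabet `{0, 1}` (`false` is `0` and `true` is `1`),
with the wreath recursion `a = (b, a)σ`, `b = (b, a)`: both states move to `b` on reading `0`
and to `a` on reading `1`, the state `a` changes the letter read, and `b` keeps it. -/
def lampAutomaton : InvAutomaton LampState Bool where
  next _ x := match x with
    | false => LampState.b
    | true => LampState.a
  out q := match q with
    | LampState.a => Equiv.swap false true
    | LampState.b => 1

/-- The generator `a = (b, a)σ` of the lamplighter group. -/
def lampA : TreeAut Bool := lampAutomaton.toTreeAut LampState.a

/-- The generator `b = (b, a)` of the lamplighter group. -/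
def lampB : TreeAut Bool := lampAutomaton.toTreeAut LampState.b

theorem lampA_smul_cons_false (w : List Bool) :
    lampA • (false :: w) = true :: lampB • w := rfl

theorem lampA_smul_cons_true (w : List Bool) :
    lampA • (true :: w) = false :: lampA • w := rfl

theorem lampB_smul_cons_false (w : List Bool) :
    lampB • (false :: w) = false :: lampB • w := rfl

theorem lampB_smul_cons_true (w : List Bool) :
    lampB • (true :: w) = true :: lampA • w := rfl

/-- The orbit tree of a subgroup of the automorphism group of the binary tree. -/
abbrev binaryOrbitTree (G : Subgroup (TreeAut Bool)) :
    SimpleGraph (MulAction.orbitRel.Quotient G (List Bool)) :=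
  orbitTree G (wordTree Bool)

/-! ### The boundary action -/

/-! Read an infinite word `ξ` as a power series over the field with two elements. Then `a`
multiplies `1 + tξ` by `1 + t`, so `a ^ (2 ^ k)` multiplies it by `1 + t ^ (2 ^ k)`
(`lampA_pow_two_pow_smul`): it fixes all words shorter than `2 ^ k` and flips the letter of index `2
^ k - 1`. A word `v` thus has one child orbit if `|v| + 1` is a power of two. Otherwise the
stabilizer of `v` in `⟨a⟩` also fixes both words below `v`, and there are two
(`lampA_zpow_smul_concat`). Since `b` fixes the first letter and acts as `b` below `0` and as `a`
below `1`, its orbit tree splits as claimed (`subtreeIsoTo_of_smul_cons`).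

For the ergodic components, it is enough to have a continuous invariant surjection `N` onto the
Cantor space whose fibres are orbit closures (`nonempty_homeomorph_ergodicMeasures`). Each fibre
then carries exactly one invariant probability measure, and these are the ergodic ones. For `a`,
such an `N` records the free letters of a normal form in which all letters of index `2 ^ i - 1` are
`0`. For `b`, this map is applied to what follows the first `1`. -/

theorem wordPrefix_eq_iff {X : Type*} {ξ η : ℕ → X} {n : ℕ} :
    wordPrefix ξ n = wordPrefix η n ↔ ∀ i < n, ξ i = η i := by
  simp [wordPrefix]

theorem wordPrefix_smul {X : Type*} (g : TreeAut X) (ξ : ℕ → X) (n : ℕ) :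
    wordPrefix (g • ξ) n = g • wordPrefix ξ n :=
  wordPrefix_boundaryMap g ξ n

theorem exists_wordPrefix_eq {X : Type*} [Nonempty X] (w : List X) :
    ∃ ξ : ℕ → X, wordPrefix ξ w.length = w := by
  obtain ⟨x⟩ := ‹Nonempty X›
  refine ⟨fun i => w.getD i x, List.ext_getElem (by simp [wordPrefix]) fun i h₁ h₂ => ?_⟩
  simp [wordPrefix, h₂]

theorem preimage_wordPrefix_singleton {X : Type*} (ξ : ℕ → X) (n : ℕ) :
    (fun η => wordPrefix η n) ⁻¹' {wordPrefix ξ n} = PiNat.cylinder ξ n := by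
  ext η
  simp [wordPrefix_eq_iff, PiNat.mem_cylinder_iff]

theorem continuous_of_forall_wordPrefix {X Y : Type*} [TopologicalSpace X] [DiscreteTopology X]
    [TopologicalSpace Y] {f : (ℕ → X) → Y} (n : ℕ)
    (h : ∀ ξ η, wordPrefix ξ n = wordPrefix η n → f ξ = f η) : Continuous f := by
  refine IsLocallyConstant.continuous ((IsLocallyConstant.iff_exists_open f).2 fun ξ => ?_)
  refine ⟨PiNat.cylinder ξ n, PiNat.isOpen_cylinder _ ξ n, PiNat.self_mem_cylinder ξ n,
    fun η hη => h _ _ ?_⟩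
  rw [← preimage_wordPrefix_singleton] at hη
  exact hη

theorem TreeAut.continuous_smul {X : Type*} [TopologicalSpace X] [DiscreteTopology X]
    (g : TreeAut X) : Continuous fun ξ : ℕ → X => g • ξ := by
  refine continuous_pi fun n => continuous_of_forall_wordPrefix (n + 1) fun ξ η h => ?_
  have h' : wordPrefix (g • ξ) (n + 1) = wordPrefix (g • η) (n + 1) := by
    rw [wordPrefix_smul, wordPrefix_smul, h]
  exact wordPrefix_eq_iff.1 h' n n.lt_succ_self

instance : ContinuousConstSMul (TreeAut Bool) (ℕ → Bool) := ⟨TreeAut.continuous_smul⟩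

/-! ### Invariant measures -/

theorem smulInvariantMeasure_zpowers_iff {G α : Type*} [Group G] [MulAction G α]
    [MeasurableSpace α] [MeasurableConstSMul G α] (g : G) (μ : Measure α) :
    SMulInvariantMeasure (Subgroup.zpowers g) α μ ↔ μ.map (g • ·) = μ := by
  constructor
  · intro h
    ext s hs
    rw [Measure.map_apply (measurable_const_smul g) hs]
    exact h.measure_preimage_smul ⟨g, Subgroup.mem_zpowers g⟩ hs
  · intro h
    have key : ∀ c ∈ Subgroup.zpowers g, μ.map (c • ·) = μ := by
      intro c hc
      rw [Subgroup.zpowers_eq_closure] at hc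
      induction hc using Subgroup.closure_induction with
      | mem x hx => rw [Set.mem_singleton_iff.1 hx, h]
      | one => simp
      | mul x y _ _ hx hy =>
        have : (fun z : α => (x * y) • z) = (x • ·) ∘ (y • ·) := by
          funext z; exact mul_smul x y z
        rw [this, ← Measure.map_map (measurable_const_smul x) (measurable_const_smul y), hy, hx]
      | inv x _ hx =>
        conv_lhs => rw [← hx]
        rw [Measure.map_map (measurable_const_smul x⁻¹) (measurable_const_smul x)]
        simp [Function.comp_def]
    refine ⟨fun c s hs => ?_⟩
    conv_rhs => rw [← key c c.2]
    rw [Measure.map_apply (measurable_const_smul (c : G)) hs]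
    rfl

/-- Two finite measures on the boundary of the binary tree that agree on all cylinders are
equal. -/
theorem measure_ext_of_cylinder {μ ν : Measure (ℕ → Bool)} [IsFiniteMeasure μ]
    (h : ∀ ξ n, μ (PiNat.cylinder ξ n) = ν (PiNat.cylinder ξ n)) : μ = ν := by
  refine ext_of_generate_finite {s | ∃ ξ n, s = PiNat.cylinder ξ n} ?_ ?_ ?_ ?_
  · rw [← (PiNat.isTopologicalBasis_cylinders fun _ => Bool).borel_eq_generateFrom]
    exact BorelSpace.measurable_eq
  · rintro _ ⟨ξ, m, rfl⟩ _ ⟨η, n, rfl⟩ ⟨ζ, h₁, h₂⟩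
    refine ⟨ζ, max m n, ?_⟩
    rw [PiNat.mem_cylinder_iff_eq] at h₁ h₂
    rw [← h₁, ← h₂]
    ext x
    simp only [Set.mem_inter_iff, PiNat.mem_cylinder_iff, lt_max_iff]
    exact ⟨fun h i hi => hi.elim (h.1 i) (h.2 i), fun h => ⟨fun i hi => h i (.inl hi),
      fun i hi => h i (.inr hi)⟩⟩
  · rintro _ ⟨ξ, n, rfl⟩
    exact h ξ n
  · simpa using h (fun _ => false) 0

/-! ### Ergodic measures as fibres of a continuous invariant map. -/

section ErgodicComponents

open Filter Topology

variable {g : TreeAut Bool} {N : (ℕ → Bool) → (ℕ → Bool)}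

theorem measure_cylinder_smul {μ : Measure (ℕ → Bool)}
    (hμ : SMulInvariantMeasure (Subgroup.zpowers g) (ℕ → Bool) μ) {n : ℕ} (k : ℤ)
    (v : List Bool) :
    μ ((fun ξ => wordPrefix ξ n) ⁻¹' {(g ^ k) • v}) = μ ((fun ξ => wordPrefix ξ n) ⁻¹' {v}) := by
  have hm : Continuous fun ξ : ℕ → Bool => (g ^ k) • ξ := continuous_const_smul _
  have hs : MeasurableSet ((fun ξ : ℕ → Bool => wordPrefix ξ n) ⁻¹' {(g ^ k) • v}) := by
    by_cases h : ∃ ξ : ℕ → Bool, wordPrefix ξ n = (g ^ k) • v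
    · obtain ⟨ξ, hξ⟩ := h
      rw [← hξ, preimage_wordPrefix_singleton]
      exact (PiNat.isOpen_cylinder _ ξ n).measurableSet
    -- Only words of length `n` are prefixes of this length; for any other word the set is empty.
    · convert MeasurableSet.empty
      ext ξ
      simpa using fun h' => h ⟨ξ, h'⟩
  rw [← hμ.measure_preimage_smul ⟨g ^ k, k, rfl⟩ hs]
  congr 1
  ext ξ
  simp only [Set.mem_preimage, Set.mem_singleton_iff]
  change wordPrefix ((g ^ k) • ξ) n = _ ↔ _
  rw [wordPrefix_smul, smul_left_cancel_iff]

/-- Almost every point lies in the fibre of `η`, so its prefix lies in the orbit of the prefix of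
`η`; invariance spreads the mass evenly over that orbit. -/
theorem measure_cylinder_eq_ite {μ : Measure (ℕ → Bool)}
    (hμ : SMulInvariantMeasure (Subgroup.zpowers g) (ℕ → Bool) μ)
    (hfib : ∀ ξ η, N ξ = N η → ∀ n, ∃ k : ℤ, (g ^ k) • wordPrefix ξ n = wordPrefix η n)
    {η : ℕ → Bool} (hN : N =ᵐ[μ] fun _ => N η) (n : ℕ) (v : List Bool)
    [Decidable (∃ k : ℤ, (g ^ k) • wordPrefix η n = v)] :
    μ ((fun ξ => wordPrefix ξ n) ⁻¹' {v}) =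
      if ∃ k : ℤ, (g ^ k) • wordPrefix η n = v then
        μ ((fun ξ => wordPrefix ξ n) ⁻¹' {wordPrefix η n}) else 0 := by
  split_ifs with h
  · obtain ⟨k, rfl⟩ := h
    exact measure_cylinder_smul hμ k _
  · refine measure_mono_null (fun ξ hξ => ?_) hN
    intro hξ'
    obtain ⟨k, hk⟩ := hfib η ξ (Eq.symm hξ') n
    exact h ⟨k, hk.trans hξ⟩

/-- There is at most one invariant probability measure on every fibre of `N`. -/
theorem invariantMeasure_unique {μ ν : Measure (ℕ → Bool)} [IsProbabilityMeasure μ]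
    [IsProbabilityMeasure ν]
    (hμ : SMulInvariantMeasure (Subgroup.zpowers g) (ℕ → Bool) μ)
    (hν : SMulInvariantMeasure (Subgroup.zpowers g) (ℕ → Bool) ν)
    (hfib : ∀ ξ η, N ξ = N η → ∀ n, ∃ k : ℤ, (g ^ k) • wordPrefix ξ n = wordPrefix η n)
    {η : ℕ → Bool} (hNμ : N =ᵐ[μ] fun _ => N η) (hNν : N =ᵐ[ν] fun _ => N η) : μ = ν := by
  classical
  have total : ∀ (ρ : Measure (ℕ → Bool)) [IsProbabilityMeasure ρ] (n : ℕ),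
      ∑ v ∈ (List.finite_length_eq Bool n).toFinset, ρ ((fun ξ => wordPrefix ξ n) ⁻¹' {v}) = 1 := by
    intro ρ _ n
    rw [sum_measure_preimage_singleton]
    · convert measure_univ (μ := ρ)
      ext ξ
      simp [length_wordPrefix]
    · intro v hv
      obtain ⟨ξ, hξ⟩ := exists_wordPrefix_eq v
      have hl : v.length = n := by simpa using hv
      rw [hl] at hξ
      rw [← hξ, preimage_wordPrefix_singleton]
      exact (PiNat.isOpen_cylinder _ ξ n).measurableSet
  -- Both masses are the reciprocal of the size of the orbit of `wordPrefix η n`.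
  have base : ∀ n, μ ((fun ξ => wordPrefix ξ n) ⁻¹' {wordPrefix η n}) =
      ν ((fun ξ => wordPrefix ξ n) ⁻¹' {wordPrefix η n}) := by
    intro n
    have h₁ := total μ n
    have h₂ := total ν n
    rw [Finset.sum_congr rfl fun v _ => measure_cylinder_eq_ite hμ hfib hNμ n v,
      ← Finset.sum_filter, Finset.sum_const, nsmul_eq_mul] at h₁
    rw [Finset.sum_congr rfl fun v _ => measure_cylinder_eq_ite hν hfib hNν n v,
      ← Finset.sum_filter, Finset.sum_const, nsmul_eq_mul] at h₂
    rw [ENNReal.eq_inv_of_mul_eq_one_left ((mul_comm _ _).trans h₁),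
      ENNReal.eq_inv_of_mul_eq_one_left ((mul_comm _ _).trans h₂)]
  refine measure_ext_of_cylinder fun ξ n => ?_
  rw [← preimage_wordPrefix_singleton, measure_cylinder_eq_ite hμ hfib hNμ,
    measure_cylinder_eq_ite hν hfib hNν, base]

/-- Living on one fibre of `N` becomes a condition on the pushforward, which depends continuously on
`μ` in the weak topology. -/
theorem map_eq_diracProba_iff (hN : Continuous N) (μ : ProbabilityMeasure (ℕ → Bool))
    (c : ℕ → Bool) :
    μ.map hN.measurable.aemeasurable = diracProba c ↔
      N =ᵐ[(μ : Measure (ℕ → Bool))] fun _ => c := by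
  have hs : MeasurableSet ({c}ᶜ : Set (ℕ → Bool)) := (measurableSet_singleton c).compl
  constructor
  · intro h
    have h' := congrArg (fun ν : ProbabilityMeasure (ℕ → Bool) =>
      (ν : Measure (ℕ → Bool)) {c}ᶜ) h
    simp only [ProbabilityMeasure.toMeasure_map] at h'
    rw [Measure.map_apply hN.measurable hs, diracProba_toMeasure_apply] at h'
    rw [EventuallyEq, ae_iff]
    simpa [Set.preimage, Set.compl_ofPred] using h'
  · intro h
    apply Subtype.ext
    change Measure.map N (μ : Measure (ℕ → Bool)) = Measure.dirac c
    rw [Measure.map_congr h, Measure.map_const]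
    simp

/-- Every orbit closure carries an invariant probability measure. -/
theorem exists_invariantMeasure (hN : Continuous N) (hinv : ∀ ξ, N (g • ξ) = N ξ)
    (η : ℕ → Bool) : ∃ μ : ProbabilityMeasure (ℕ → Bool),
      (μ : Measure (ℕ → Bool)).map (g • ·) = μ ∧
      μ.map hN.measurable.aemeasurable = diracProba (N η) := by
  have hinv' : ∀ k : ℕ, N (g ^ k • η) = N η := by
    intro k
    induction k with
    | zero => simp
    | succ k ih => rw [pow_succ', mul_smul, hinv, ih]
  -- Krylov–Bogolyubov: average Dirac masses along the orbit of `η`, then take a weak limit along a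
  -- nonprincipal ultrafilter, which exists by compactness.
  let m : ℕ → Measure (ℕ → Bool) := fun n =>
    ((n + 1 : ℕ) : ENNReal)⁻¹ • ∑ k ∈ Finset.range (n + 1), Measure.dirac (g ^ k • η)
  have hm : ∀ n, IsProbabilityMeasure (m n) := fun n => ⟨by
    simp only [m, Measure.smul_apply, Measure.coe_finsetSum, Finset.sum_apply, measure_univ,
      Finset.sum_const, Finset.card_range, nsmul_eq_mul, mul_one, smul_eq_mul]
    exact ENNReal.inv_mul_cancel (by simp) (by simp)⟩
  let u : ℕ → ProbabilityMeasure (ℕ → Bool) := fun n => ⟨m n, hm n⟩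
  let F : Ultrafilter (ProbabilityMeasure (ℕ → Bool)) := (hyperfilter ℕ).map u
  have hu : Tendsto u (hyperfilter ℕ) (𝓝 F.lim) := F.le_nhds_lim
  have hint : ∀ n (f : BoundedContinuousFunction (ℕ → Bool) ℝ),
      ∫ x, f x ∂(u n : Measure (ℕ → Bool)) =
        ((n + 1 : ℕ) : ℝ)⁻¹ * ∑ k ∈ Finset.range (n + 1), f (g ^ k • η) := by
    intro n f
    change ∫ x, f x ∂(m n) = _
    simp only [m]
    rw [integral_smul_measure, integral_finsetSum_measure]
    · rw [ENNReal.toReal_inv, ENNReal.toReal_natCast, smul_eq_mul]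
      simp
    · intro k _
      exact f.integrable _
  refine ⟨F.lim, ?_, ?_⟩
  · have : IsProbabilityMeasure ((F.lim : Measure (ℕ → Bool)).map (g • ·)) :=
      Measure.isProbabilityMeasure_map (measurable_const_smul g).aemeasurable
    refine ext_of_forall_integral_eq_of_IsFiniteMeasure fun f => ?_
    rw [integral_map (measurable_const_smul g).aemeasurable
      f.continuous.measurable.aestronglyMeasurable]
    let f' : BoundedContinuousFunction (ℕ → Bool) ℝ :=
      f.compContinuous ⟨fun ξ => g • ξ, continuous_const_smul g⟩
    have h₁ := ProbabilityMeasure.tendsto_iff_forall_integral_tendsto.1 hu f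
    have h₂ := ProbabilityMeasure.tendsto_iff_forall_integral_tendsto.1 hu f'
    -- Shifting by `g` telescopes the average, leaving two boundary terms divided by `n + 1`.
    have h₃ : Tendsto (fun n => ∫ x, f' x ∂(u n : Measure (ℕ → Bool)) -
        ∫ x, f x ∂(u n : Measure (ℕ → Bool))) (hyperfilter ℕ) (𝓝 0) := by
      refine Tendsto.mono_left ?_ Nat.hyperfilter_le_atTop
      refine squeeze_zero_norm (a := fun n : ℕ => (2 * ‖f‖) / ((n : ℝ) + 1)) (fun n => ?_) ?_
      · have : ∫ x, f' x ∂(u n : Measure (ℕ → Bool)) - ∫ x, f x ∂(u n : Measure (ℕ → Bool)) =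
            ((n + 1 : ℕ) : ℝ)⁻¹ * (f (g ^ (n + 1) • η) - f (g ^ 0 • η)) := by
          rw [hint, hint, ← mul_sub, ← Finset.sum_sub_distrib,
            ← Finset.sum_range_sub (fun k => f (g ^ k • η))]
          congr 1
          refine Finset.sum_congr rfl fun k _ => ?_
          rw [pow_succ' g k, mul_smul]
          rfl
        rw [this, norm_mul, norm_inv, Real.norm_natCast, inv_mul_eq_div]
        push_cast
        gcongr
        calc _ ≤ ‖f (g ^ (n + 1) • η)‖ + ‖f (g ^ 0 • η)‖ := norm_sub_le _ _
          _ ≤ ‖f‖ + ‖f‖ := add_le_add (f.norm_coe_le_norm _) (f.norm_coe_le_norm _)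
          _ = 2 * ‖f‖ := by ring
      · exact Tendsto.div_atTop tendsto_const_nhds
          (tendsto_atTop_add_const_right _ _ tendsto_natCast_atTop_atTop)
    exact sub_eq_zero.1 (tendsto_nhds_unique (h₂.sub h₁) h₃)
  -- All averages live on the fibre of `η`, so their pushforwards equal one Dirac mass, and so does
  -- that of the limit.
  · have h₁ := ((ProbabilityMeasure.continuous_map hN).tendsto F.lim).comp hu
    refine tendsto_nhds_unique h₁ (tendsto_const_nhds.congr fun n => Eq.symm ?_)
    refine (map_eq_diracProba_iff hN _ _).2 ?_
    change N =ᵐ[m n] _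
    have hmeas : MeasurableSet {x | ¬ N x = N η} :=
      (hN.measurable (measurableSet_singleton (N η))).compl
    rw [EventuallyEq, ae_iff]
    simp only [m, Measure.smul_apply, Measure.coe_finsetSum, Finset.sum_apply, smul_eq_mul]
    rw [Finset.sum_eq_zero, mul_zero]
    intro k _
    rw [Measure.dirac_apply' _ hmeas]
    simp [hinv']

/-- An invariant probability measure is ergodic if and only if it lives on one fibre of `N`. -/
theorem mem_ergodicMeasures_iff (hN : Continuous N) (hsurj : Function.Surjective N)
    (hinv : ∀ ξ, N (g • ξ) = N ξ)
    (hfib : ∀ ξ η, N ξ = N η → ∀ n, ∃ k : ℤ, (g ^ k) • wordPrefix ξ n = wordPrefix η n)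
    (μ : ProbabilityMeasure (ℕ → Bool)) :
    μ ∈ ergodicMeasures (Subgroup.zpowers g) ↔ (μ : Measure (ℕ → Bool)).map (g • ·) = μ ∧
      ∃ c, μ.map hN.measurable.aemeasurable = diracProba c := by
  rw [← smulInvariantMeasure_zpowers_iff]
  constructor
  · intro h
    have h' : ErgodicSMul (Subgroup.zpowers g) (ℕ → Bool) (μ : Measure (ℕ → Bool)) := h
    refine ⟨h'.toSMulInvariantMeasure, ?_⟩
    have hinv' : ∀ (c : Subgroup.zpowers g) ξ, N (c • ξ) = N ξ := by
      rintro ⟨c, hc⟩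
      change ∀ ξ : ℕ → Bool, N (c • ξ) = N ξ
      rw [Subgroup.zpowers_eq_closure] at hc
      induction hc using Subgroup.closure_induction with
      | mem x hx => rw [Set.mem_singleton_iff.1 hx]; exact hinv
      | one => simp
      | mul x y _ _ hx hy => intro ξ; rw [mul_smul, hx, hy]
      | inv x _ hx => intro ξ; rw [← hx, smul_inv_smul]
    -- Preimages under `N` are invariant, hence null or conull; as measurable sets separate points,
    -- `N` is almost everywhere constant.
    obtain ⟨c, hc⟩ := exists_eventuallyEq_const_of_forall_separating
      (l := ae (μ : Measure (ℕ → Bool))) (f := N) MeasurableSet fun U hU => by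
        have := h'.aeconst_of_forall_preimage_smul_ae_eq (hN.measurable hU) fun c => by
          rw [← Set.preimage_comp]
          refine Eventually.of_forall fun ξ => ?_
          change (N (c • ξ) ∈ U) = (N ξ ∈ U)
          rw [hinv']
        rcases eventuallyConst_set.1 this with h | h
        · exact .inl h
        · exact .inr h
    exact ⟨c, (map_eq_diracProba_iff hN μ c).2 hc⟩
  · rintro ⟨hμ, c, hc⟩
    obtain ⟨η, rfl⟩ := hsurj c
    rw [map_eq_diracProba_iff hN] at hc
    have := hμ
    refine ⟨fun {s} hs hsi => ?_⟩
    rw [eventuallyConst_set']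
    by_cases h0 : (μ : Measure (ℕ → Bool)) s = 0
    · exact .inl (ae_eq_empty.2 h0)
    right
    -- Conditioning on an invariant set of positive measure gives an invariant measure on the same
    -- fibre. By uniqueness it is `μ`, so the set is conull.
    have hcp : IsProbabilityMeasure (ProbabilityTheory.cond (μ : Measure (ℕ → Bool)) s) :=
      ProbabilityTheory.cond_isProbabilityMeasure h0
    have hcμ : ProbabilityTheory.cond (μ : Measure (ℕ → Bool)) s = μ := by
      refine invariantMeasure_unique (g := g) (N := N) ⟨fun k t ht => ?_⟩ hμ hfib (η := η) ?_ hc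
      · rw [ProbabilityTheory.cond_apply hs, ProbabilityTheory.cond_apply hs,
          ← hμ.measure_preimage_smul k (hs.inter ht), Set.preimage_inter]
        congr 1
        exact measure_congr ((hsi k).symm.inter (ae_eq_refl _))
      · exact ProbabilityTheory.cond_absolutelyContinuous.ae_eq hc
    rw [ae_eq_univ, ← hcμ, ProbabilityTheory.cond_apply hs]
    simp

/-- If the fibres of the invariant map `N` are orbit closures, then the space of ergodic
components is homeomorphic to the range of `N`. -/
theorem nonempty_homeomorph_ergodicMeasures (hN : Continuous N) (hsurj : Function.Surjective N)
    (hinv : ∀ ξ, N (g • ξ) = N ξ)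
    (hfib : ∀ ξ η, N ξ = N η → ∀ n, ∃ k : ℤ, (g ^ k) • wordPrefix ξ n = wordPrefix η n) :
    Nonempty (ergodicMeasures (Subgroup.zpowers g) ≃ₜ cantorSet) := by
  have hiff := mem_ergodicMeasures_iff hN hsurj hinv hfib
  have hmap := ProbabilityMeasure.continuous_map hN
  -- Ergodicity is a closed condition here, since the Dirac masses form a compact set; thus a
  -- continuous bijection out of this space is a homeomorphism.
  have hclosed : IsClosed (ergodicMeasures (Subgroup.zpowers g)) := by
    have : ergodicMeasures (Subgroup.zpowers g) =
        {μ | μ.map (continuous_const_smul g).measurable.aemeasurable = μ} ∩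
        (fun μ : ProbabilityMeasure (ℕ → Bool) => μ.map hN.measurable.aemeasurable) ⁻¹'
          Set.range fun c => diracProba c := by
      ext μ
      rw [hiff, Set.mem_inter_iff, Set.mem_preimage, Set.mem_range, Set.mem_ofPred_eq,
        ← ProbabilityMeasure.toMeasure_injective.eq_iff, ProbabilityMeasure.toMeasure_map]
      simp only [eq_comm]
    rw [this]
    refine IsClosed.inter (isClosed_eq ?_ continuous_id) (IsClosed.preimage hmap ?_)
    · exact ProbabilityMeasure.continuous_map (continuous_const_smul g)
    · exact (isCompact_range continuous_diracProba).isClosed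
  have : CompactSpace (ergodicMeasures (Subgroup.zpowers g)) :=
    isCompact_iff_compactSpace.1 hclosed.isCompact
  choose F hF using fun μ : ergodicMeasures (Subgroup.zpowers g) => ((hiff μ).1 μ.2).2
  have hFc : Continuous F := by
    rw [isEmbedding_diracProba.continuous_iff]
    refine (hmap.comp continuous_subtype_val).congr fun μ => hF μ
  have hFb : Function.Bijective F := by
    constructor
    · intro μ ν h
      obtain ⟨η, hη⟩ := hsurj (F μ)
      have h₁ := (map_eq_diracProba_iff hN _ _).1 (hF μ)
      have h₂ := (map_eq_diracProba_iff hN _ _).1 (hF ν)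
      rw [← h, ← hη] at h₂
      rw [← hη] at h₁
      have i₁ : ErgodicSMul (Subgroup.zpowers g) (ℕ → Bool) _ := μ.2
      have i₂ : ErgodicSMul (Subgroup.zpowers g) (ℕ → Bool) _ := ν.2
      exact Subtype.ext <| ProbabilityMeasure.toMeasure_injective <|
        invariantMeasure_unique i₁.toSMulInvariantMeasure i₂.toSMulInvariantMeasure hfib h₁ h₂
    · intro c
      obtain ⟨η, rfl⟩ := hsurj c
      obtain ⟨μ, h₁, h₂⟩ := exists_invariantMeasure hN hinv η
      refine ⟨⟨μ, (hiff μ).2 ⟨h₁, _, h₂⟩⟩, ?_⟩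
      refine isEmbedding_diracProba.injective ?_
      exact (hF _).symm.trans h₂
  have hFc' : Continuous (Equiv.ofBijective F hFb) := hFc
  exact ⟨hFc'.homeoOfEquivCompactToT2.trans cantorSetHomeomorphNatToBool.symm⟩

end ErgodicComponents

/-! ### Distances, levels and children in orbit trees. -/

section OrbitTree

variable {X : Type*} {G : Subgroup (TreeAut X)}

theorem wordTree_adj_length {v w : List X} (h : (wordTree X).Adj v w) :
    w.length = v.length + 1 ∨ v.length = w.length + 1 := by
  rcases h with ⟨x, rfl⟩ | ⟨x, rfl⟩ <;> simp

theorem orbit_mk_eq_iff {v w : List X} :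
    (Quotient.mk _ v : MulAction.orbitRel.Quotient G (List X)) = Quotient.mk _ w ↔
      ∃ g : G, g • w = v := by
  rw [Quotient.eq, MulAction.orbitRel_apply, MulAction.mem_orbit_iff]

theorem orbit_mk_length_eq {v w : List X}
    (h : (Quotient.mk _ v : MulAction.orbitRel.Quotient G (List X)) = Quotient.mk _ w) :
    v.length = w.length := by
  obtain ⟨g, rfl⟩ := orbit_mk_eq_iff.1 h
  exact TreeAut.length_smul (g : TreeAut X) w

theorem orbit_mk_smul (g : G) (v : List X) :
    (Quotient.mk _ (g • v) : MulAction.orbitRel.Quotient G (List X)) = Quotient.mk _ v :=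
  orbit_mk_eq_iff.2 ⟨g, rfl⟩

theorem orbitTree_adj_mk_iff {v w : List X} :
    (orbitTree G (wordTree X)).Adj (Quotient.mk _ v) (Quotient.mk _ w) ↔
      ∃ g : G, (wordTree X).Adj (g • v) w := by
  constructor
  · rintro ⟨-, v', hv, w', hw, h⟩
    rw [MulAction.orbitRel.Quotient.mem_orbit] at hv hw
    obtain ⟨g, rfl⟩ := orbit_mk_eq_iff.1 hv
    obtain ⟨k, rfl⟩ := orbit_mk_eq_iff.1 hw
    refine ⟨k⁻¹ * g, ?_⟩
    have : (wordTree X).Adj (k⁻¹ • g • v) (k⁻¹ • k • w) := TreeAut.smul_adj (k⁻¹ : G).1 h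
    rwa [inv_smul_smul, ← mul_smul] at this
  · rintro ⟨g, h⟩
    refine ⟨fun e => ?_, g • v, ?_, w, ?_, h⟩
    · rw [← orbit_mk_smul g] at e
      have := orbit_mk_length_eq e
      have := wordTree_adj_length h
      omega
    · exact MulAction.orbitRel.Quotient.mem_orbit.2 (orbit_mk_smul g v)
    · exact MulAction.orbitRel.Quotient.mem_orbit.2 rfl

/-- Each edge changes the word length by one. A walk that gains its full length only ever appends
letters, up to the group action; this computes distances and identifies the hanging subtrees. -/
theorem orbitTree_walk_length {O P : MulAction.orbitRel.Quotient G (List X)}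
    (p : (orbitTree G (wordTree X)).Walk O P) {v w : List X}
    (hv : Quotient.mk _ v = O) (hw : Quotient.mk _ w = P) :
    w.length ≤ v.length + p.length ∧
      (w.length = v.length + p.length → ∃ g : G, g • v <+: w) := by
  induction p generalizing v with
  | nil =>
    subst hv
    obtain ⟨g, rfl⟩ := orbit_mk_eq_iff.1 hw
    exact ⟨(TreeAut.length_smul (g : TreeAut X) v).le, fun _ => ⟨g, List.prefix_rfl⟩⟩
  | @cons O O' P h p ih =>
    obtain ⟨u, rfl⟩ := Quotient.exists_rep O'
    subst hv
    obtain ⟨g, hg⟩ := orbitTree_adj_mk_iff.1 h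
    have hl := wordTree_adj_length hg
    have hgl : (g • v).length = v.length := TreeAut.length_smul (g : TreeAut X) v
    obtain ⟨h₁, h₂⟩ := ih rfl hw
    rw [SimpleGraph.Walk.length_cons]
    refine ⟨by omega, fun e => ?_⟩
    obtain ⟨k, hk⟩ := h₂ (by omega)
    refine ⟨k * g, List.IsPrefix.trans ?_ hk⟩
    rcases hg with ⟨x, rfl⟩ | ⟨x, hx⟩
    · obtain ⟨y, hy⟩ := TreeAut.smul_concat (k : TreeAut X) (g • v) x
      exact ⟨[y], by rw [mul_smul]; exact hy.symm⟩
    · have := congrArg List.length hx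
      simp only [List.length_append, List.length_singleton] at this
      omega

theorem orbitTree_edist_append (v u : List X) :
    (orbitTree G (wordTree X)).edist (Quotient.mk _ v) (Quotient.mk _ (v ++ u)) = u.length := by
  apply le_antisymm
  · induction u using List.reverseRecOn with
    | nil => simp
    | append_singleton u x ih =>
      refine (SimpleGraph.edist_triangle (v := Quotient.mk _ (v ++ u))).trans ?_
      rw [List.length_append, Nat.cast_add]
      refine add_le_add ih ?_
      have : (orbitTree G (wordTree X)).Adj (Quotient.mk _ (v ++ u))
          (Quotient.mk _ (v ++ (u ++ [x]))) :=
        orbitTree_adj_mk_iff.2 ⟨1, by rw [one_smul]; exact .inl ⟨x, by simp⟩⟩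
      rw [SimpleGraph.edist_eq_one_iff_adj.2 this]
      simp
  · refine le_iInf fun p => ?_
    have := (orbitTree_walk_length p rfl rfl).1
    rw [List.length_append] at this
    exact_mod_cast Nat.le_of_add_le_add_left this

theorem orbitTree_edist_root (w : List X) :
    (orbitTree G (wordTree X)).edist (orbitRoot G) (Quotient.mk _ w) = w.length :=
  orbitTree_edist_append [] w

theorem mk_mem_treeLevel_iff {w : List X} {n : ℕ} :
    Quotient.mk _ w ∈ treeLevel (orbitTree G (wordTree X)) (orbitRoot G) n ↔ w.length = n := by
  change (orbitTree G (wordTree X)).edist (orbitRoot G) (Quotient.mk _ w) = n ↔ _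
  rw [orbitTree_edist_root]
  exact Nat.cast_inj

theorem treeChildren_mk (v : List X) :
    treeChildren (orbitTree G (wordTree X)) (orbitRoot G) (Quotient.mk _ v) =
      Set.range fun x => Quotient.mk _ (v ++ [x]) := by
  ext O
  obtain ⟨w, rfl⟩ := Quotient.exists_rep O
  change _ ∧ _ = _ ↔ _
  rw [orbitTree_edist_root, orbitTree_edist_root]
  constructor
  · rintro ⟨h, e⟩
    have e' : w.length = v.length + 1 := by exact_mod_cast e
    obtain ⟨g, hg⟩ := orbitTree_adj_mk_iff.1 h
    have hgl : (g • v).length = v.length := TreeAut.length_smul (g : TreeAut X) v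
    rcases hg with ⟨x, rfl⟩ | ⟨x, hx⟩
    · obtain ⟨y, hy⟩ := TreeAut.smul_concat (g⁻¹ : G).1 (g • v) x
      refine ⟨y, ?_⟩
      have hy' : g⁻¹ • (g • v ++ [x]) = g⁻¹ • g • v ++ [y] := hy
      rw [inv_smul_smul] at hy'
      change Quotient.mk _ (v ++ [y]) = _
      rw [← hy', orbit_mk_smul]
    · have := congrArg List.length hx
      simp only [List.length_append, List.length_singleton] at this
      omega
  · rintro ⟨x, hx⟩
    have hx' := orbit_mk_length_eq hx
    simp only [List.length_append, List.length_singleton] at hx'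
    rw [← hx']
    refine ⟨?_, by simp⟩
    rw [← hx]
    exact orbitTree_adj_mk_iff.2 ⟨1, by rw [one_smul]; exact .inl ⟨x, rfl⟩⟩

theorem mk_mem_treeBelow_iff {v w : List X} :
    Quotient.mk _ w ∈ treeBelow (orbitTree G (wordTree X)) (orbitRoot G) (Quotient.mk _ v) ↔
      ∃ g : G, v <+: g • w := by
  change _ = _ ↔ _
  rw [orbitTree_edist_root, orbitTree_edist_root]
  constructor
  · intro h
    have hne : (orbitTree G (wordTree X)).edist (Quotient.mk _ v) (Quotient.mk _ w) ≠ ⊤ := by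
      intro e
      rw [e] at h
      simp at h
    obtain ⟨p, hp⟩ := SimpleGraph.exists_walk_of_edist_ne_top hne
    rw [← hp] at h
    obtain ⟨g, u, hu⟩ := (orbitTree_walk_length p rfl rfl).2 (by exact_mod_cast h)
    have hgl : (g • v).length = v.length := TreeAut.length_smul (g : TreeAut X) v
    refine ⟨g⁻¹, ?_⟩
    have : ∀ u : List X, v <+: g⁻¹ • (g • v ++ u) := by
      intro u
      induction u using List.reverseRecOn with
      | nil => simp
      | append_singleton u x ih =>
        obtain ⟨y, hy⟩ := TreeAut.smul_concat (g⁻¹ : G).1 (g • v ++ u) x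
        refine ih.trans ⟨[y], ?_⟩
        rw [← List.append_assoc]
        exact hy.symm
    rw [← hu]
    exact this u
  · rintro ⟨g, u, hu⟩
    have hgl : (g • w).length = w.length := TreeAut.length_smul (g : TreeAut X) w
    rw [← orbit_mk_smul g w, ← hu, orbitTree_edist_append, ← hgl, ← hu]
    simp

end OrbitTree

/-! ### Subtrees hanging below a fixed letter. -/

section Section

variable {X : Type*} {g h : TreeAut X} {x : X}

theorem zpow_smul_cons (hg : ∀ w, g • (x :: w) = x :: h • w) (k : ℤ) (w : List X) :
    (g ^ k) • (x :: w) = x :: (h ^ k) • w := by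
  have hinv : ∀ w, g⁻¹ • (x :: w) = x :: h⁻¹ • w := by
    intro w
    rw [inv_smul_eq_iff, hg, smul_inv_smul]
  induction k generalizing w with
  | zero => simp
  | succ k ih => rw [zpow_add_one, zpow_add_one, mul_smul, mul_smul, hg, ih]
  | pred k ih => rw [zpow_sub_one, zpow_sub_one, mul_smul, mul_smul, hinv, ih]

theorem wordTree_adj_cons_iff {v w : List X} :
    (wordTree X).Adj (x :: v) (x :: w) ↔ (wordTree X).Adj v w := by
  simp [wordTree]

/-- If `g` fixes the letter `x` and acts below it as `h`, then the orbit tree of `⟨g⟩` below `x`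
is the orbit tree of `⟨h⟩`. -/
theorem subtreeIsoTo_of_smul_cons (hg : ∀ w, g • (x :: w) = x :: h • w) :
    SubtreeIsoTo (orbitTree (Subgroup.zpowers g) (wordTree X)) (orbitRoot (Subgroup.zpowers g))
      (Quotient.mk _ [x]) (orbitTree (Subgroup.zpowers h) (wordTree X))
      (orbitRoot (Subgroup.zpowers h)) := by
  have key : ∀ v w : List X,
      (Quotient.mk _ (x :: v) : MulAction.orbitRel.Quotient (Subgroup.zpowers g) (List X)) =
        Quotient.mk _ (x :: w) ↔
      (Quotient.mk _ v : MulAction.orbitRel.Quotient (Subgroup.zpowers h) (List X)) =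
        Quotient.mk _ w := by
    intro v w
    rw [orbit_mk_eq_iff, orbit_mk_eq_iff]
    constructor
    · rintro ⟨⟨_, k, rfl⟩, e⟩
      have e' : (g ^ k) • (x :: w) = x :: v := e
      rw [zpow_smul_cons hg, List.cons.injEq] at e'
      exact ⟨⟨_, k, rfl⟩, e'.2⟩
    · rintro ⟨⟨_, k, rfl⟩, e⟩
      have e' : (h ^ k) • w = v := e
      refine ⟨⟨_, k, rfl⟩, ?_⟩
      change (g ^ k) • (x :: w) = x :: v
      rw [zpow_smul_cons hg, e']
  let ψ : MulAction.orbitRel.Quotient (Subgroup.zpowers h) (List X) →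
      treeBelow (orbitTree (Subgroup.zpowers g) (wordTree X)) (orbitRoot (Subgroup.zpowers g))
        (Quotient.mk _ [x]) :=
    Quotient.lift (fun w => ⟨Quotient.mk _ (x :: w),
      mk_mem_treeBelow_iff.2 ⟨1, by rw [one_smul]; exact ⟨w, rfl⟩⟩⟩) fun v w e =>
        Subtype.ext ((key v w).2 (Quotient.sound e))
  have hψ : Function.Bijective ψ := by
    constructor
    · intro O P e
      obtain ⟨v, rfl⟩ := Quotient.exists_rep O
      obtain ⟨w, rfl⟩ := Quotient.exists_rep P
      exact (key v w).1 (congrArg Subtype.val e)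
    -- Every orbit below that of `[x]` contains a word beginning with `x`.
    · rintro ⟨O, hO⟩
      obtain ⟨w, rfl⟩ := Quotient.exists_rep O
      obtain ⟨k, u, hu⟩ := mk_mem_treeBelow_iff.1 hO
      refine ⟨Quotient.mk _ u, Subtype.ext ?_⟩
      change Quotient.mk _ ([x] ++ u) = _
      rw [hu, orbit_mk_smul]
  let φ : orbitTree (Subgroup.zpowers h) (wordTree X) ≃g
      (orbitTree (Subgroup.zpowers g) (wordTree X)).induce
        (treeBelow (orbitTree (Subgroup.zpowers g) (wordTree X))
          (orbitRoot (Subgroup.zpowers g)) (Quotient.mk _ [x])) :=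
    { Equiv.ofBijective ψ hψ with
      map_rel_iff' := by
        intro O P
        obtain ⟨v, rfl⟩ := Quotient.exists_rep O
        obtain ⟨w, rfl⟩ := Quotient.exists_rep P
        change (orbitTree (Subgroup.zpowers g) (wordTree X)).Adj (Quotient.mk _ (x :: v))
          (Quotient.mk _ (x :: w)) ↔ _
        rw [orbitTree_adj_mk_iff, orbitTree_adj_mk_iff]
        constructor
        · rintro ⟨⟨_, k, rfl⟩, e⟩
          have e' : (wordTree X).Adj ((g ^ k) • (x :: v)) (x :: w) := e
          rw [zpow_smul_cons hg, wordTree_adj_cons_iff] at e'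
          exact ⟨⟨_, k, rfl⟩, e'⟩
        · rintro ⟨⟨_, k, rfl⟩, e⟩
          have e' : (wordTree X).Adj ((h ^ k) • v) w := e
          refine ⟨⟨_, k, rfl⟩, ?_⟩
          change (wordTree X).Adj ((g ^ k) • (x :: v)) (x :: w)
          rwa [zpow_smul_cons hg, wordTree_adj_cons_iff] }
  refine ⟨φ.symm, fun y hy => ?_⟩
  rw [← φ.symm_apply_apply (orbitRoot (Subgroup.zpowers h))]
  exact congrArg _ (Subtype.ext hy)

end Section

/-! ### The boundary action of the lamplighter generators -/

/-- The infinite word `xη`. -/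
def consSeq {X : Type*} (x : X) (η : ℕ → X) : ℕ → X
  | 0 => x
  | n + 1 => η n

theorem consSeq_eta {X : Type*} (ξ : ℕ → X) : consSeq (ξ 0) (fun n => ξ (n + 1)) = ξ := by
  funext n
  cases n <;> rfl

theorem wordPrefix_consSeq {X : Type*} (x : X) (η : ℕ → X) (n : ℕ) :
    wordPrefix (consSeq x η) (n + 1) = x :: wordPrefix η n := by
  simp [wordPrefix, List.range_succ_eq_map, consSeq]

theorem smul_consSeq {X : Type*} {g h : TreeAut X} {x y : X}
    (hg : ∀ w, g • (x :: w) = y :: h • w) (η : ℕ → X) :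
    g • consSeq x η = consSeq y (h • η) := by
  refine wordPrefix_injective (funext fun n => ?_)
  cases n with
  | zero => rfl
  | succ n => rw [wordPrefix_smul, wordPrefix_consSeq, wordPrefix_consSeq, hg, wordPrefix_smul]

theorem lampA_smul_eq (ξ : ℕ → Bool) :
    lampA • ξ = consSeq (!ξ 0) (if ξ 0 then lampA • (fun n => ξ (n + 1))
      else lampB • (fun n => ξ (n + 1))) := by
  conv_lhs => rw [← consSeq_eta ξ]
  cases ξ 0
  · exact smul_consSeq lampA_smul_cons_false _
  · exact smul_consSeq lampA_smul_cons_true _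

theorem lampB_smul_eq (ξ : ℕ → Bool) :
    lampB • ξ = consSeq (ξ 0) (if ξ 0 then lampA • (fun n => ξ (n + 1))
      else lampB • (fun n => ξ (n + 1))) := by
  conv_lhs => rw [← consSeq_eta ξ]
  cases ξ 0
  · exact smul_consSeq lampB_smul_cons_false _
  · exact smul_consSeq lampB_smul_cons_true _

/-- The state reached after a letter depends on that letter alone: `a` after `1`, `b` after `0`. So
the next letter is flipped exactly when the current one is `1`. -/
theorem lamp_smul_apply_succ (n : ℕ) (ξ : ℕ → Bool) :
    (lampA • ξ) (n + 1) = ((ξ (n + 1)).xor (ξ n)) ∧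
      (lampB • ξ) (n + 1) = ((ξ (n + 1)).xor (ξ n)) := by
  induction n generalizing ξ with
  | zero =>
    rw [lampA_smul_eq ξ, lampB_smul_eq ξ]
    simp only [consSeq]
    cases h : ξ 0
    · simp [lampB_smul_eq, consSeq]
    · simp [lampA_smul_eq, consSeq]
  | succ n ih =>
    rw [lampA_smul_eq ξ, lampB_smul_eq ξ]
    simp only [consSeq]
    obtain ⟨h₁, h₂⟩ := ih fun n => ξ (n + 1)
    cases h : ξ 0
    · simp [h₂]
    · simp [h₁]

/-- In terms of power series over the field with two elements, `a ^ (2 ^ k)` acts as the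
multiplication of `1 + tξ` by `1 + t ^ (2 ^ k)`. -/
theorem lampA_pow_two_pow_smul (k : ℕ) (ξ : ℕ → Bool) (i : ℕ) :
    (lampA ^ 2 ^ k • ξ) i =
      if i + 1 < 2 ^ k then ξ i else (ξ i).xor (consSeq true ξ (i + 1 - 2 ^ k)) := by
  induction k generalizing ξ i with
  | zero =>
    cases i with
    | zero => simp [lampA_smul_eq, consSeq]
    | succ i => simp [(lamp_smul_apply_succ i ξ).1, consSeq]
  | succ k ih =>
    have hpos : 0 < 2 ^ k := by positivity
    -- This is the induction hypothesis for the whole series `1 + tξ`, including its constant term.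
    have hcons : ∀ j, consSeq true (lampA ^ 2 ^ k • ξ) j = if j < 2 ^ k then consSeq true ξ j else
        (consSeq true ξ j).xor (consSeq true ξ (j - 2 ^ k)) := by
      intro j
      cases j with
      | zero => simp [consSeq]
      | succ j => exact ih ξ j
    have hpow : 2 ^ (k + 1) = 2 ^ k + 2 ^ k := by ring
    -- Squaring `1 + t ^ (2 ^ k)`: the two cross terms cancel modulo 2.
    rw [hpow, pow_add, mul_smul, ih, ih, hcons]
    by_cases h₁ : i + 1 < 2 ^ k
    · simp [h₁, show i + 1 < 2 ^ k + 2 ^ k by omega]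
    · by_cases h₂ : i + 1 < 2 ^ k + 2 ^ k
      · simp [h₁, h₂, show i + 1 - 2 ^ k < 2 ^ k by omega]
      · simp [h₁, h₂, show ¬ i + 1 - 2 ^ k < 2 ^ k by omega, Nat.sub_sub]

theorem lampA_pow_two_pow_smul_of_lt {k i : ℕ} (ξ : ℕ → Bool) (h : i + 1 < 2 ^ k) :
    (lampA ^ 2 ^ k • ξ) i = ξ i := by
  rw [lampA_pow_two_pow_smul, if_pos h]

theorem lampA_pow_two_pow_smul_of_eq {k i : ℕ} (ξ : ℕ → Bool) (h : i + 1 = 2 ^ k) :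
    (lampA ^ 2 ^ k • ξ) i = !ξ i := by
  rw [lampA_pow_two_pow_smul, if_neg (by omega), h]
  simp [consSeq]

theorem lampA_pow_two_pow_smul_word {k : ℕ} {v : List Bool} (h : v.length < 2 ^ k) :
    lampA ^ 2 ^ k • v = v := by
  obtain ⟨ξ, hξ⟩ := exists_wordPrefix_eq v
  conv_rhs => rw [← hξ]
  conv_lhs => rw [← hξ]
  rw [← wordPrefix_smul, wordPrefix_eq_iff]
  exact fun i hi => lampA_pow_two_pow_smul_of_lt ξ (by omega)

theorem lampA_pow_two_pow_smul_concat {k : ℕ} {v : List Bool} (h : v.length + 1 = 2 ^ k)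
    (x : Bool) : lampA ^ 2 ^ k • (v ++ [x]) = v ++ [!x] := by
  obtain ⟨ξ, hξ⟩ := exists_wordPrefix_eq (v ++ [x])
  rw [List.length_append, List.length_singleton, wordPrefix_succ] at hξ
  obtain ⟨h₁, h₂⟩ := List.append_inj' hξ rfl
  have h₁' : wordPrefix (lampA ^ 2 ^ k • ξ) v.length = v := by
    rw [wordPrefix_smul, h₁, lampA_pow_two_pow_smul_word (by omega)]
  rw [← hξ, ← wordPrefix_succ, ← wordPrefix_smul, wordPrefix_succ, h₁',
    lampA_pow_two_pow_smul_of_eq ξ h]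
  simp_all

theorem length_lt_of_lampA_pow_two_pow_smul_word {k : ℕ} {v : List Bool}
    (h : lampA ^ 2 ^ k • v = v) : v.length < 2 ^ k := by
  by_contra hlt
  have hpos : 0 < 2 ^ k := by positivity
  obtain ⟨ξ, hξ⟩ := exists_wordPrefix_eq v
  rw [← hξ, ← wordPrefix_smul, wordPrefix_eq_iff] at h
  have h' := h (2 ^ k - 1) (by omega)
  rw [lampA_pow_two_pow_smul_of_eq ξ (by omega)] at h'
  simp at h'

/-- Off the levels `2 ^ n - 1`, the two words below a given word lie in different orbits. -/
theorem lampA_zpow_smul_concat {v : List Bool} (hv : ∀ n, v.length + 1 ≠ 2 ^ n) {k : ℤ}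
    {x y : Bool} (h : (lampA ^ k) • (v ++ [x]) = v ++ [y]) : x = y := by
  have hk : (lampA ^ k) • v = v := by
    obtain ⟨z, hz⟩ := TreeAut.smul_concat (lampA ^ k) v x
    exact (List.append_inj' (hz.symm.trans h) rfl).1
  have hj : (lampA ^ ((2 ^ v.length : ℕ) : ℤ)) • v = v := by
    rw [zpow_natCast]
    exact lampA_pow_two_pow_smul_word Nat.lt_two_pow_self
  -- The gcd of `k` and `2 ^ v.length` is a power `2 ^ i`, and by Bézout `a ^ (2 ^ i)` fixes `v`,
  -- whence `v.length < 2 ^ i`. As `v.length + 1 ≠ 2 ^ i`, there is room for one more letter, so `a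
  -- ^ (2 ^ i)` and its power `a ^ k` fix `v ++ [x]`.
  obtain ⟨i, -, hi⟩ := (Nat.dvd_prime_pow Nat.prime_two).1
    (Int.natCast_dvd_natCast.1 (Int.gcd_dvd_right k ((2 ^ v.length : ℕ) : ℤ)))
  have hg : (lampA ^ ((Int.gcd k ((2 ^ v.length : ℕ) : ℤ) : ℕ) : ℤ)) • v = v := by
    rw [Int.gcd_eq_gcd_ab, zpow_add, zpow_mul, zpow_mul]
    exact (MulAction.stabilizer (TreeAut Bool) v).mul_mem
      (Subgroup.zpow_mem _ hk _) (Subgroup.zpow_mem _ hj _)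
  rw [hi, zpow_natCast] at hg
  have hlt := length_lt_of_lampA_pow_two_pow_smul_word hg
  obtain ⟨q, hq⟩ := Int.gcd_dvd_left k ((2 ^ v.length : ℕ) : ℤ)
  have hfix : lampA ^ 2 ^ i • (v ++ [x]) = v ++ [x] := by
    refine lampA_pow_two_pow_smul_word ?_
    have := hv i
    simp only [List.length_append, List.length_singleton]
    omega
  have hfix' : (lampA ^ k) • (v ++ [x]) = v ++ [x] := by
    rw [hq, hi, zpow_mul, zpow_natCast]
    exact Subgroup.zpow_mem (MulAction.stabilizer (TreeAut Bool) (v ++ [x])) hfix q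
  simpa using (hfix'.symm.trans h)

theorem treeChildren_bool {G : Subgroup (TreeAut Bool)} (v : List Bool) :
    treeChildren (binaryOrbitTree G) (orbitRoot G) (Quotient.mk _ v) =
      {Quotient.mk _ (v ++ [false]), Quotient.mk _ (v ++ [true])} := by
  rw [treeChildren_mk]
  ext O
  simp

theorem ncard_treeChildren_lampA_of_eq {v : List Bool} {n : ℕ} (hv : v.length + 1 = 2 ^ n) :
    (treeChildren (binaryOrbitTree (Subgroup.zpowers lampA))
      (orbitRoot (Subgroup.zpowers lampA)) (Quotient.mk _ v)).ncard = 1 := by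
  have : (Quotient.mk _ (v ++ [false]) :
      MulAction.orbitRel.Quotient (Subgroup.zpowers lampA) (List Bool)) =
      Quotient.mk _ (v ++ [true]) :=
    orbit_mk_eq_iff.2 ⟨⟨lampA ^ 2 ^ n, Subgroup.npow_mem_zpowers _ _⟩,
      lampA_pow_two_pow_smul_concat hv true⟩
  rw [treeChildren_bool, this]
  simp

theorem ncard_treeChildren_lampA_of_ne {v : List Bool} (hv : ∀ n, v.length + 1 ≠ 2 ^ n) :
    (treeChildren (binaryOrbitTree (Subgroup.zpowers lampA))
      (orbitRoot (Subgroup.zpowers lampA)) (Quotient.mk _ v)).ncard = 2 := by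
  rw [treeChildren_bool]
  refine Set.ncard_pair fun e => ?_
  obtain ⟨⟨_, k, rfl⟩, h⟩ := orbit_mk_eq_iff.1 e
  exact absurd (lampA_zpow_smul_concat hv h) (by simp)

/-! ### Normal forms of the orbit closures -/

/-- Two infinite words have the same orbit closure under `⟨g⟩` (they define the same end of the
orbit tree). -/
def SameOrbitClosure {X : Type*} (g : TreeAut X) (ξ η : ℕ → X) : Prop :=
  ∀ n, ∃ k : ℤ, (g ^ k) • wordPrefix ξ n = wordPrefix η n

namespace SameOrbitClosure

variable {X : Type*} {g : TreeAut X} {ξ η ζ : ℕ → X}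

theorem symm (h : SameOrbitClosure g ξ η) : SameOrbitClosure g η ξ := fun n => by
  obtain ⟨k, hk⟩ := h n
  exact ⟨-k, by rw [← hk, zpow_neg, inv_smul_smul]⟩

theorem trans (h₁ : SameOrbitClosure g ξ η) (h₂ : SameOrbitClosure g η ζ) :
    SameOrbitClosure g ξ ζ := fun n => by
  obtain ⟨k, hk⟩ := h₁ n
  obtain ⟨l, hl⟩ := h₂ n
  exact ⟨l + k, by rw [zpow_add, mul_smul, hk, hl]⟩

theorem smul (g : TreeAut X) (ξ : ℕ → X) : SameOrbitClosure g ξ (g • ξ) := fun n =>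
  ⟨1, by rw [zpow_one, wordPrefix_smul]⟩

end SameOrbitClosure

/-- The first `j` steps of the reduction of an infinite word to its normal form: the `i`-th step
applies `a ^ (2 ^ i)` if necessary to make the letter with the index `2 ^ i - 1` equal to `0`. -/
def lampReduce : ℕ → (ℕ → Bool) → ℕ → Bool
  | 0, ξ => ξ
  | j + 1, ξ => fun n => bif lampReduce j ξ (2 ^ j - 1) then (lampA ^ 2 ^ j • lampReduce j ξ) n
      else lampReduce j ξ n

theorem lampReduce_succ (j : ℕ) (ξ : ℕ → Bool) :
    lampReduce (j + 1) ξ = bif lampReduce j ξ (2 ^ j - 1) then lampA ^ 2 ^ j • lampReduce j ξ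
      else lampReduce j ξ := by
  funext n
  rw [lampReduce]
  cases lampReduce j ξ (2 ^ j - 1) <;> rfl

theorem continuous_lampReduce (j : ℕ) : Continuous (lampReduce j) := by
  induction j with
  | zero => exact continuous_id
  | succ j ih =>
    refine continuous_pi fun n => ?_
    have h : Continuous fun p : Bool × Bool × Bool => bif p.1 then p.2.1 else p.2.2 :=
      continuous_of_discreteTopology
    exact h.comp (((continuous_apply _).comp ih).prodMk
      (((continuous_apply n).comp ((continuous_const_smul (lampA ^ 2 ^ j)).comp ih)).prodMk
        ((continuous_apply n).comp ih)))

theorem exists_lampReduce_eq (j : ℕ) (ξ : ℕ → Bool) :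
    ∃ k : ℤ, lampReduce j ξ = (lampA ^ k) • ξ := by
  induction j with
  | zero => exact ⟨0, by simp [lampReduce]⟩
  | succ j ih =>
    obtain ⟨k, hk⟩ := ih
    rw [lampReduce_succ]
    cases lampReduce j ξ (2 ^ j - 1)
    · exact ⟨k, hk⟩
    · refine ⟨((2 ^ j : ℕ) : ℤ) + k, ?_⟩
      rw [zpow_add, mul_smul, zpow_natCast, ← hk]
      rfl

theorem lampReduce_succ_apply_of_lt {j i : ℕ} (ξ : ℕ → Bool) (h : i + 1 < 2 ^ j) :
    lampReduce (j + 1) ξ i = lampReduce j ξ i := by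
  rw [lampReduce_succ]
  cases lampReduce j ξ (2 ^ j - 1)
  · rfl
  · exact lampA_pow_two_pow_smul_of_lt _ h

theorem lampReduce_apply_two_pow {i j : ℕ} (ξ : ℕ → Bool) (h : i < j) :
    lampReduce j ξ (2 ^ i - 1) = false := by
  have hpos : 0 < 2 ^ i := by positivity
  induction j with
  | zero => omega
  | succ j ih =>
    rcases (Nat.lt_succ_iff_lt_or_eq.1 h) with h | rfl
    · have := Nat.pow_lt_pow_right (a := 2) (by norm_num) h
      rw [lampReduce_succ_apply_of_lt ξ (by omega), ih h]
    · rw [lampReduce_succ]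
      cases hi : lampReduce i ξ (2 ^ i - 1)
      · exact hi
      · rw [cond_true, lampA_pow_two_pow_smul_of_eq (k := i) _ (by omega), hi]
        rfl

/-- Step `j` leaves the letters of index below `2 ^ j - 1` alone, and `j ≤ 2 ^ j - 1`; hence each
letter stabilizes and the diagonal is a limit. -/
theorem lampReduce_apply_of_le {n j : ℕ} (ξ : ℕ → Bool) (h : n + 1 ≤ j) :
    lampReduce j ξ n = lampReduce (n + 1) ξ n := by
  induction j, h using Nat.le_induction with
  | base => rfl
  | succ j hj ih =>
    have := Nat.lt_two_pow_self (n := j)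
    rw [lampReduce_succ_apply_of_lt ξ (by omega), ih]

/-- The normal form of an infinite word under `⟨a⟩`. -/
def lampNormalForm (ξ : ℕ → Bool) (n : ℕ) : Bool := lampReduce (n + 1) ξ n

theorem continuous_lampNormalForm : Continuous lampNormalForm :=
  continuous_pi fun n => (continuous_apply n).comp (continuous_lampReduce (n + 1))

theorem lampNormalForm_apply_two_pow (ξ : ℕ → Bool) {n i : ℕ} (h : n + 1 = 2 ^ i) :
    lampNormalForm ξ n = false := by
  obtain rfl : n = 2 ^ i - 1 := by omega
  rw [lampNormalForm, h]
  exact lampReduce_apply_two_pow ξ Nat.lt_two_pow_self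

theorem sameOrbitClosure_lampNormalForm (ξ : ℕ → Bool) :
    SameOrbitClosure lampA ξ (lampNormalForm ξ) := by
  intro n
  obtain ⟨k, hk⟩ := exists_lampReduce_eq n ξ
  refine ⟨k, ?_⟩
  rw [← wordPrefix_smul, ← hk, wordPrefix_eq_iff]
  exact fun i hi => lampReduce_apply_of_le ξ hi

/-- Uniqueness of the normal form: letters of index `2 ^ i - 1` are prescribed, and every other
letter is determined by the orbit once the earlier letters agree. -/
theorem SameOrbitClosure.eq_of_normal {ξ η : ℕ → Bool} (h : SameOrbitClosure lampA ξ η)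
    (hξ : ∀ n i, n + 1 = 2 ^ i → ξ n = false) (hη : ∀ n i, n + 1 = 2 ^ i → η n = false) :
    ξ = η := by
  refine wordPrefix_injective (funext fun n => ?_)
  induction n with
  | zero => rfl
  | succ n ih =>
    rw [wordPrefix_succ, wordPrefix_succ, ih]
    by_cases hn : ∃ i, n + 1 = 2 ^ i
    · obtain ⟨i, hi⟩ := hn
      rw [hξ n i hi, hη n i hi]
    · obtain ⟨k, hk⟩ := h (n + 1)
      rw [wordPrefix_succ, wordPrefix_succ, ih] at hk
      rw [lampA_zpow_smul_concat ?_ hk]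
      rw [length_wordPrefix]
      exact fun i hi => hn ⟨i, hi⟩

theorem lampNormalForm_eq_iff {ξ η : ℕ → Bool} :
    lampNormalForm ξ = lampNormalForm η ↔ SameOrbitClosure lampA ξ η := by
  constructor
  · intro h
    have h' := sameOrbitClosure_lampNormalForm ξ
    rw [h] at h'
    exact h'.trans (sameOrbitClosure_lampNormalForm η).symm
  · intro h
    exact (((sameOrbitClosure_lampNormalForm ξ).symm.trans h).trans
      (sameOrbitClosure_lampNormalForm η)).eq_of_normal
        (fun n i => lampNormalForm_apply_two_pow ξ) (fun n i => lampNormalForm_apply_two_pow η)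

/-- The orbit closures of `⟨a⟩` are the fibres of a continuous map onto the Cantor space. -/
theorem exists_quotientMap_lampA : ∃ N : (ℕ → Bool) → ℕ → Bool, Continuous N ∧
    Function.Surjective N ∧ ∀ ξ η, N ξ = N η ↔ SameOrbitClosure lampA ξ η := by
  classical
  have : Infinite {n : ℕ // ∀ i, n + 1 ≠ 2 ^ i} := by
    -- For `n = 2 * m + 2` the number `n + 1` is odd and greater than `1`.
    refine Infinite.of_injective (fun m : ℕ => ⟨2 * m + 2, fun i hi => ?_⟩) fun m n h => ?_
    · cases i with
      | zero => simp at hi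
      | succ i => rw [pow_succ] at hi; omega
    · simpa using h
  obtain ⟨e⟩ := nonempty_equiv_of_countable (α := ℕ) (β := {n : ℕ // ∀ i, n + 1 ≠ 2 ^ i})
  refine ⟨fun ξ n => lampNormalForm ξ (e n), ?_, fun c => ?_, fun ξ η => ?_⟩
  · exact continuous_pi fun n => continuous_pi_iff.1 continuous_lampNormalForm (e n)
  · let ξ : ℕ → Bool := fun n => if h : ∀ i, n + 1 ≠ 2 ^ i then c (e.symm ⟨n, h⟩) else false
    -- A word with zeros at the prescribed places is its own normal form, so the remaining letters
    -- are free.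
    have hξ : lampNormalForm ξ = ξ := by
      refine (sameOrbitClosure_lampNormalForm ξ).symm.eq_of_normal
        (fun n i => lampNormalForm_apply_two_pow ξ) fun n i hi => ?_
      exact dif_neg fun h => h i hi
    refine ⟨ξ, funext fun n => ?_⟩
    change lampNormalForm ξ (e n) = _
    rw [hξ]
    simp only [ξ]
    rw [dif_pos (e n).2]
    simp
  · rw [← lampNormalForm_eq_iff]
    refine ⟨fun h => funext fun n => ?_, fun h => by simp only [h]⟩
    by_cases hn : ∀ i, n + 1 ≠ 2 ^ i
    · simpa using congrFun h (e.symm ⟨n, hn⟩)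
    · push Not at hn
      obtain ⟨i, hi⟩ := hn
      rw [lampNormalForm_apply_two_pow ξ hi, lampNormalForm_apply_two_pow η hi]

/-- The map `0ⁿ1ξ ↦ 0ⁿ1N(ξ)` on infinite words. -/
def applyAfterOne (N : (ℕ → Bool) → ℕ → Bool) : (ℕ → Bool) → ℕ → Bool
  | ξ, 0 => ξ 0
  | ξ, n + 1 => bif ξ 0 then N (fun m => ξ (m + 1)) n
      else applyAfterOne N (fun m => ξ (m + 1)) n

theorem applyAfterOne_eq (N : (ℕ → Bool) → ℕ → Bool) (ξ : ℕ → Bool) :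
    applyAfterOne N ξ = consSeq (ξ 0) (bif ξ 0 then N (fun m => ξ (m + 1))
      else applyAfterOne N (fun m => ξ (m + 1))) := by
  funext n
  cases n with
  | zero => rfl
  | succ n => rw [applyAfterOne, consSeq]; cases ξ 0 <;> rfl

theorem continuous_applyAfterOne {N : (ℕ → Bool) → ℕ → Bool} (hN : Continuous N) :
    Continuous (applyAfterOne N) := by
  refine continuous_pi fun n => ?_
  induction n with
  | zero => exact continuous_apply 0
  | succ n ih =>
    have h : Continuous fun p : Bool × Bool × Bool => bif p.1 then p.2.1 else p.2.2 :=
      continuous_of_discreteTopology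
    have ht : Continuous fun (ξ : ℕ → Bool) m => ξ (m + 1) :=
      continuous_pi fun m => continuous_apply (m + 1)
    exact h.comp ((continuous_apply 0).prodMk
      (((continuous_apply n).comp (hN.comp ht)).prodMk (ih.comp ht)))

theorem surjective_applyAfterOne {N : (ℕ → Bool) → ℕ → Bool} (hN : Function.Surjective N) :
    Function.Surjective (applyAfterOne N) := by
  obtain ⟨S, hS⟩ := hN.hasRightInverse
  -- A right inverse `S` of `N`, continuous or not, lifts by the same construction.
  suffices h : ∀ n c, applyAfterOne N (applyAfterOne S c) n = c n from
    fun c => ⟨applyAfterOne S c, funext fun n => h n c⟩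
  intro n
  induction n with
  | zero => intro c; rfl
  | succ n ih =>
    intro c
    rw [applyAfterOne_eq S c, applyAfterOne]
    simp only [consSeq]
    cases h : c 0
    · exact ih _
    · exact congrFun (hS _) n

/-- Powers of `b` pass to the tail: to the same power of `b` after `0`, where the induction
continues, and of `a` after `1`, where `N` decides. -/
theorem sameOrbitClosure_lampB_of_applyAfterOne_eq {N : (ℕ → Bool) → ℕ → Bool}
    (hN : ∀ ξ η, N ξ = N η ↔ SameOrbitClosure lampA ξ η) {ξ η : ℕ → Bool}
    (h : applyAfterOne N ξ = applyAfterOne N η) : SameOrbitClosure lampB ξ η := by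
  intro n
  induction n generalizing ξ η with
  | zero => exact ⟨0, by simp [wordPrefix]⟩
  | succ n ih =>
    have h₀ : ξ 0 = η 0 := congrFun h 0
    have ht : ∀ m, applyAfterOne N ξ (m + 1) = applyAfterOne N η (m + 1) :=
      fun m => congrFun h (m + 1)
    simp only [applyAfterOne, ← h₀] at ht
    rw [← consSeq_eta ξ, ← consSeq_eta η, wordPrefix_consSeq, wordPrefix_consSeq, ← h₀]
    cases hx : ξ 0
    · simp only [hx, cond_false] at ht
      obtain ⟨k, hk⟩ := ih (funext ht)
      exact ⟨k, by rw [zpow_smul_cons lampB_smul_cons_false, hk]⟩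
    · simp only [hx, cond_true] at ht
      obtain ⟨k, hk⟩ := (hN _ _).1 (funext ht) n
      exact ⟨k, by rw [zpow_smul_cons lampB_smul_cons_true, hk]⟩

theorem applyAfterOne_lampB_smul {N : (ℕ → Bool) → ℕ → Bool}
    (hN : ∀ ξ, N (lampA • ξ) = N ξ) (ξ : ℕ → Bool) :
    applyAfterOne N (lampB • ξ) = applyAfterOne N ξ := by
  funext n
  induction n generalizing ξ with
  | zero => rw [lampB_smul_eq]; rfl
  | succ n ih =>
    rw [lampB_smul_eq, applyAfterOne, applyAfterOne]
    simp only [consSeq]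
    cases ξ 0
    · exact ih _
    · exact congrFun (hN _) n

/-! ### Conclusions for the two generators. -/

theorem nonempty_homeomorph_ergodicMeasures_lampA :
    Nonempty (ergodicMeasures (Subgroup.zpowers lampA) ≃ₜ cantorSet) := by
  obtain ⟨N, hc, hs, hN⟩ := exists_quotientMap_lampA
  exact nonempty_homeomorph_ergodicMeasures hc hs
    (fun ξ => (hN _ _).2 (SameOrbitClosure.smul lampA ξ).symm) fun ξ η h => (hN ξ η).1 h

theorem nonempty_homeomorph_ergodicMeasures_lampB :
    Nonempty (ergodicMeasures (Subgroup.zpowers lampB) ≃ₜ cantorSet) := by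
  obtain ⟨N, hc, hs, hN⟩ := exists_quotientMap_lampA
  exact nonempty_homeomorph_ergodicMeasures (continuous_applyAfterOne hc)
    (surjective_applyAfterOne hs)
    (applyAfterOne_lampB_smul fun ξ => (hN _ _).2 (SameOrbitClosure.smul lampA ξ).symm)
    fun ξ η h => sameOrbitClosure_lampB_of_applyAfterOne_eq hN h

theorem mainTheorem3 :
    -- (a) the orbit tree and the ergodic components of the group generated by `a`
    ((∀ (m : ℕ),
        ∀ O ∈ treeLevel (binaryOrbitTree (Subgroup.zpowers lampA))
            (orbitRoot (Subgroup.zpowers lampA)) m,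
          ((∃ n : ℕ, m = 2 ^ n - 1) →
            (treeChildren (binaryOrbitTree (Subgroup.zpowers lampA))
              (orbitRoot (Subgroup.zpowers lampA)) O).ncard = 1) ∧
          ((¬ ∃ n : ℕ, m = 2 ^ n - 1) →
            (treeChildren (binaryOrbitTree (Subgroup.zpowers lampA))
              (orbitRoot (Subgroup.zpowers lampA)) O).ncard = 2)) ∧
      Nonempty (ergodicMeasures (Subgroup.zpowers lampA) ≃ₜ cantorSet)) ∧
    -- (b) the orbit tree and the ergodic components of the group generated by `b`
    ((∃ c₀ c₁ : MulAction.orbitRel.Quotient (Subgroup.zpowers lampB) (List Bool),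
        c₀ ≠ c₁ ∧
        treeChildren (binaryOrbitTree (Subgroup.zpowers lampB))
          (orbitRoot (Subgroup.zpowers lampB)) (orbitRoot (Subgroup.zpowers lampB)) = {c₀, c₁} ∧
        SubtreeIsoTo (binaryOrbitTree (Subgroup.zpowers lampB))
          (orbitRoot (Subgroup.zpowers lampB)) c₀
          (binaryOrbitTree (Subgroup.zpowers lampB)) (orbitRoot (Subgroup.zpowers lampB)) ∧
        SubtreeIsoTo (binaryOrbitTree (Subgroup.zpowers lampB))
          (orbitRoot (Subgroup.zpowers lampB)) c₁
          (binaryOrbitTree (Subgroup.zpowers lampA)) (orbitRoot (Subgroup.zpowers lampA))) ∧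
      Nonempty (ergodicMeasures (Subgroup.zpowers lampB) ≃ₜ cantorSet)) := by
  refine ⟨⟨fun m O hO => ?_, nonempty_homeomorph_ergodicMeasures_lampA⟩, ⟨?_, ?_⟩⟩
  · obtain ⟨v, rfl⟩ := Quotient.exists_rep O
    have hv : v.length = m := mk_mem_treeLevel_iff.1 hO
    subst hv
    constructor
    · rintro ⟨n, hn⟩
      have hpos : 0 < 2 ^ n := by positivity
      exact ncard_treeChildren_lampA_of_eq (n := n) (by omega)
    · exact fun h => ncard_treeChildren_lampA_of_ne fun n hn => h ⟨n, by omega⟩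
  · refine ⟨Quotient.mk _ [false], Quotient.mk _ [true], fun e => ?_, treeChildren_bool [],
      subtreeIsoTo_of_smul_cons lampB_smul_cons_false,
      subtreeIsoTo_of_smul_cons lampB_smul_cons_true⟩
    obtain ⟨⟨_, k, rfl⟩, h⟩ := orbit_mk_eq_iff.1 e
    have h' : (lampB ^ k) • [true] = [false] := h
    rw [zpow_smul_cons lampB_smul_cons_true] at h'
    simp at h'
  · exact nonempty_homeomorph_ergodicMeasures_lampB
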